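/- Let $\mathcal L$ be the set of cumulative distribution functions (CDFs) on $\mathbb R$. For $F,G\in\mathcal L$ let $W_1(F,G)=\inf_{\pi}\int_{\mathbb R^2}|x-y|\,d\pi(x,y)\in[0,\infty]$ be the Wasserstein distance, where the infimum is over all joint distributions $\pi$ on $\mathbb R^2$ with marginals $F$ and $G$. For $F\in\mathcal L$ and $\tau>0$ let $F|_\tau\in\mathcal L$ be the truncated CDF $$F|_\tau(x)=F(x)\,\mathbf 1\{-\tau\le x<\tau\}+\mathbf 1\{x\ge\tau\}.$$ A risk measure is a map $\rho:\mathcal L\to\mathbb R$; for a random variable $X$ with CDF $F$ we write $\rho(X)=\rho(F)$. The risk measure $\rho$ is of Type 2, with the positive constants $\alpha_1,\alpha_2,\alpha_3,L_1,L_2,L_3,K_1,K_2,\gamma$, if for all $F,G\in\mathcal L$ and all $\tau>0$, $$|\rho(F)-\rho(G|_\tau)|\le L_1\,W_1(F,G)^{\alpha_1}\,\tau^\gamma+L_2\int_{K_1\tau}^{\infty}[1-F(z)]^{\alpha_2}\,dz+L_3\int_{-\infty}^{-K_2\tau}[F(z)]^{\alpha_3}\,dz ,$$ where the right-hand side may be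 $+\infty$. **Theorem.** Let $B_1,B_2$ be real numbers, at least one of them positive. There are constants $c_1,c_2>0$, depending only on $B_1$ and $B_2$, such that the following holds. Let $X$ be a random variable with $X\in[-B_2,B_1]$ almost surely, let $\rho$ be a risk measure of Type 2 with constants $\alpha_1,\alpha_2,\alpha_3,L_1,L_2,L_3,K_1,K_2,\gamma$, let $n\ge1$, let $X_1,\dots,X_n$ be independent random variables with the distribution of $X$, let $F_n(x)=\frac1n\sum_{i=1}^n\mathbf 1\{X_i\le x\}$ be their empirical distribution function, and let $\rho_n=\rho(F_n)$. Then for every $\epsilon>0$, $$\mathbb P\big(|\rho_n-\rho(X)|>\epsilon\big)\le c_1\exp\left(-c_2\,n\left[\frac{\epsilon}{L_1\tau^\gamma}\right]^{2/\alpha_1}\right),\qquad \tau=\max\left(\frac{B_1}{K_1},\frac{B_2}{K_2}\right).$$ (Here $\mathbb P$ denotes outer probability if the event is not measurable.) -/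

import Mathlib

open MeasureTheory ProbabilityTheory Set Filter Topology
open scoped ENNReal

noncomputable section

/-- A cumulative distribution function on `ℝ`: a nondecreasing, right-continuous function
with limit `0` at `-∞` and limit `1` at `+∞`. This type is the space `𝓛` of all CDFs. -/
structure DistFun extends StieltjesFunction ℝ where
  tendsto_atBot' : Tendsto toFun atBot (𝓝 0)
  tendsto_atTop' : Tendsto toFun atTop (𝓝 1)

namespace DistFun

instance : CoeFun DistFun (fun _ => ℝ → ℝ) := ⟨fun F => F.toFun⟩

/-- The probability distribution on `ℝ` whose CDF is `F`. -/
def law (F : DistFun) : Measure ℝ := F.toStieltjesFunction.measure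

/-- The CDF `x ↦ P (X ≤ x)` of a real random variable `X` on a probability space `(Ω, P)`. -/
def ofRV {Ω : Type*} [MeasurableSpace Ω] (P : Measure Ω) (X : Ω → ℝ) : DistFun where
  toStieltjesFunction := cdf (P.map X)
  tendsto_atBot' := tendsto_cdf_atBot (P.map X)
  tendsto_atTop' := tendsto_cdf_atTop (P.map X)

theorem ofRV_apply {Ω : Type*} [MeasurableSpace Ω] (P : Measure Ω) [IsProbabilityMeasure P]
    {X : Ω → ℝ} (hX : AEMeasurable X P) (x : ℝ) :
    ofRV P X x = P.real {ω | X ω ≤ x} := by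
  have : IsProbabilityMeasure (P.map X) := Measure.isProbabilityMeasure_map hX
  change cdf (P.map X) x = _
  rw [cdf_eq_real, map_measureReal_apply_of_aemeasurable hX measurableSet_Iic]
  rfl

/-- The empirical distribution function `F_n(t) = (1/n) ∑ 1{x_i ≤ t}` of a nonempty
sample `x_1, …, x_n`. -/
def empirical {n : ℕ} (hn : 1 ≤ n) (x : Fin n → ℝ) : DistFun where
  toFun t := (1 / (n : ℝ)) * ∑ i, (if x i ≤ t then 1 else 0)
  mono' := by
    intro s t hst
    have h : (0 : ℝ) ≤ 1 / (n : ℝ) := by positivity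
    refine mul_le_mul_of_nonneg_left (Finset.sum_le_sum fun i _ => ?_) h
    split_ifs with h1 h2
    · exact le_rfl
    · exact absurd (h1.trans hst) h2
    · exact zero_le_one
    · exact le_rfl
  right_continuous' := by
    intro t
    refine ContinuousWithinAt.mul continuousWithinAt_const ?_
    refine tendsto_finsetSum _ fun i _ => ?_
    by_cases h : x i ≤ t
    · refine tendsto_const_nhds.congr' ?_
      filter_upwards [self_mem_nhdsWithin] with s hs
      rw [if_pos h, if_pos (h.trans hs)]
    · refine tendsto_const_nhds.congr' ?_
      filter_upwards [mem_nhdsWithin_of_mem_nhds (Iio_mem_nhds (not_le.1 h))] with s hs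
      rw [if_neg h, if_neg (not_le.2 hs)]
  tendsto_atBot' := by
    have h : Tendsto (fun t : ℝ => (1 / (n : ℝ)) * ∑ i, (if x i ≤ t then (1 : ℝ) else 0)) atBot
        (𝓝 ((1 / (n : ℝ)) * ∑ _i : Fin n, (0 : ℝ))) := by
      refine tendsto_const_nhds.mul (tendsto_finsetSum _ fun i _ => ?_)
      refine tendsto_const_nhds.congr' ?_
      filter_upwards [eventually_lt_atBot (x i)] with s hs
      rw [if_neg (not_le.2 hs)]
    simpa using h
  tendsto_atTop' := by
    have h : Tendsto (fun t : ℝ => (1 / (n : ℝ)) * ∑ i, (if x i ≤ t then (1 : ℝ) else 0)) atTop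
        (𝓝 ((1 / (n : ℝ)) * ∑ _i : Fin n, (1 : ℝ))) := by
      refine tendsto_const_nhds.mul (tendsto_finsetSum _ fun i _ => ?_)
      refine tendsto_const_nhds.congr' ?_
      filter_upwards [eventually_ge_atTop (x i)] with s hs
      rw [if_pos hs]
    have hn' : (n : ℝ) ≠ 0 := by
      have : n ≠ 0 := by omega
      exact_mod_cast this
    have e : (1 / (n : ℝ)) * ∑ _i : Fin n, (1 : ℝ) = 1 := by
      simp [hn']
    rwa [e] at h

theorem nonneg (F : DistFun) (x : ℝ) : 0 ≤ F x :=
  le_of_tendsto_of_tendsto F.tendsto_atBot' tendsto_const_nhds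
    ((eventually_le_atBot x).mono fun _ hy => F.mono' hy)

theorem le_one (F : DistFun) (x : ℝ) : F x ≤ 1 :=
  le_of_tendsto_of_tendsto tendsto_const_nhds F.tendsto_atTop'
    ((eventually_ge_atTop x).mono fun _ hy => F.mono' hy)

/-- The truncated CDF `F|_τ (x) = F(x) 1{-τ ≤ x < τ} + 1{x ≥ τ}`. -/
def trunc (F : DistFun) (τ : ℝ) : DistFun where
  toFun x := (if -τ ≤ x ∧ x < τ then F x else 0) + (if τ ≤ x then 1 else 0)
  mono' := by
    intro s t hst
    have h0 := F.nonneg t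
    have h1 := F.le_one s
    have h2 : F s ≤ F t := F.mono' hst
    dsimp only
    split_ifs <;> first | linarith | (exfalso; grind)
  right_continuous' := by
    intro t
    by_cases h1 : τ ≤ t
    · refine (continuousWithinAt_const (b := (1 : ℝ))).congr_of_eventuallyEq_of_mem ?_
        self_mem_Ici
      filter_upwards [self_mem_nhdsWithin] with s hs
      have hs' : τ ≤ s := h1.trans hs
      rw [if_neg (fun h => absurd h.2 (not_lt.2 hs')), if_pos hs', zero_add]
    · have hlt : ∀ᶠ s in 𝓝[Ici t] t, s < τ :=
        mem_nhdsWithin_of_mem_nhds (Iio_mem_nhds (not_le.1 h1))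
      by_cases h2 : -τ ≤ t
      · refine (F.right_continuous' t).congr_of_eventuallyEq_of_mem ?_ self_mem_Ici
        filter_upwards [self_mem_nhdsWithin, hlt] with s hs hs'
        rw [if_pos ⟨h2.trans hs, hs'⟩, if_neg (not_le.2 hs'), add_zero]
      · refine (continuousWithinAt_const (b := (0 : ℝ))).congr_of_eventuallyEq_of_mem ?_
          self_mem_Ici
        filter_upwards [hlt, mem_nhdsWithin_of_mem_nhds (Iio_mem_nhds (not_le.1 h2))]
          with s hs hs'
        rw [if_neg (fun h => absurd h.1 (not_le.2 hs')), if_neg (not_le.2 hs), add_zero]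
  tendsto_atBot' := by
    refine tendsto_const_nhds.congr' ?_
    filter_upwards [eventually_lt_atBot (-τ), eventually_lt_atBot τ] with s hs hs'
    rw [if_neg (by grind), if_neg (by grind), add_zero]
  tendsto_atTop' := by
    refine tendsto_const_nhds.congr' ?_
    filter_upwards [eventually_ge_atTop τ] with s hs
    rw [if_neg (by grind), if_pos hs, zero_add]

/-- `Γ(F, G)`: the joint distributions on `ℝ²` with marginals `F` and `G`. -/
def couplings (F G : DistFun) : Set (Measure (ℝ × ℝ)) :=
  {π | π.map Prod.fst = F.law ∧ π.map Prod.snd = G.law}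

/-- The Wasserstein distance `W₁(F, G) = inf_{π ∈ Γ(F, G)} ∫ |x - y| dπ(x, y) ∈ [0, ∞]`. -/
def W₁ (F G : DistFun) : ℝ≥0∞ :=
  ⨅ π ∈ couplings F G, ∫⁻ p : ℝ × ℝ, ENNReal.ofReal |p.1 - p.2| ∂π

end DistFun

/-- A risk measure: a real-valued map on the space of CDFs. -/
abbrev RiskMeasure := DistFun → ℝ

/-- The risk measure `ρ` satisfies the truncated Hölder-continuity condition with a tail bound
(`ρ` is of Type 2) with the positive constants `α₁, α₂, α₃, L₁, L₂, L₃, K₁, K₂, γ`: for all CDFs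
`F, G` and all `τ > 0`,
`|ρ(F) - ρ(G|_τ)| ≤ L₁ W₁(F, G)^α₁ τ^γ + L₂ ∫_{K₁τ}^∞ (1 - F(z))^α₂ dz + L₃ ∫_{-∞}^{-K₂τ} F(z)^α₃ dz`.
The inequality is between elements of `[0, ∞]`, since the right-hand side may be infinite. -/
structure IsTypeTwo (ρ : RiskMeasure) (α₁ α₂ α₃ L₁ L₂ L₃ K₁ K₂ γ : ℝ) : Prop where
  α₁_pos : 0 < α₁
  α₂_pos : 0 < α₂
  α₃_pos : 0 < α₃
  L₁_pos : 0 < L₁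
  L₂_pos : 0 < L₂
  L₃_pos : 0 < L₃
  K₁_pos : 0 < K₁
  K₂_pos : 0 < K₂
  γ_pos : 0 < γ
  bound : ∀ (F G : DistFun) (τ : ℝ), 0 < τ →
    ENNReal.ofReal |ρ F - ρ (G.trunc τ)| ≤
      ENNReal.ofReal L₁ * DistFun.W₁ F G ^ α₁ * ENNReal.ofReal (τ ^ γ)
        + ENNReal.ofReal L₂ * (∫⁻ z in Ioi (K₁ * τ), ENNReal.ofReal (1 - F z) ^ α₂)
        + ENNReal.ofReal L₃ * (∫⁻ z in Iio (-(K₂ * τ)), ENNReal.ofReal (F z) ^ α₃)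

end

/-! For τ = max(B₁/K₁, B₂/K₂) the support [-B₂, B₁] lies in [-K₂τ, K₁τ], so both tail integrals in
the Type 2 condition vanish for the true CDF F and, almost surely, for F_n. The condition with equal
CDFs then shows that truncation at τ does not change ρ, and what remains is a Hölder bound in W₁
(`IsTypeTwo.abs_sub_le`). Hence a deviation of ρ above ε forces W₁(F_n, F) ≥ s^(1/α₁), where s =
ε/(L₁τ^γ).

The quantile coupling bounds W₁ by ∫|F_n - F| (`W₁_le_lintegral`), which is D times the mean of |F_n
- F| over an interval of length D containing the support. No uniform bound on |F_n - F| is needed: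
Jensen and Tonelli reduce the exponential moment of this mean to fixed x, where Hoeffding's lemma
applies, and Markov's inequality finishes (`measure_le_integral_abs_empirical_sub_le`). -/

noncomputable section

/-! ### Quantile coupling and the L¹ bound on W₁. -/

namespace DistFun

theorem mono (F : DistFun) {x y : ℝ} (h : x ≤ y) : F x ≤ F y := F.mono' h

theorem law_Iic (F : DistFun) (x : ℝ) : F.law (Iic x) = ENNReal.ofReal (F x) := by
  have h := F.toStieltjesFunction.measure_Iic F.tendsto_atBot' x
  rwa [sub_zero] at h

/-- The quantile function (left-continuous generalised inverse) of a CDF. -/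
def quantile (F : DistFun) (u : ℝ) : ℝ := sInf {x | u ≤ F x}

/-- The limits of F at ±∞ make the defining set nonempty and bounded below for u in (0, 1);
right-continuity makes its infimum attained. -/
theorem quantile_le_iff (F : DistFun) {u : ℝ} (hu : u ∈ Ioo (0 : ℝ) 1) (x : ℝ) :
    F.quantile u ≤ x ↔ u ≤ F x := by
  obtain ⟨a, ha⟩ := (F.tendsto_atBot'.eventually (Iio_mem_nhds hu.1)).exists
  obtain ⟨b, hb⟩ := (F.tendsto_atTop'.eventually (Ioi_mem_nhds hu.2)).exists
  have hbdd : BddBelow {x | u ≤ F x} := ⟨a, fun y hy => by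
    by_contra! h
    exact absurd (hy.trans (F.mono h.le)) (not_le.2 ha)⟩
  have hne : {x | u ≤ F x}.Nonempty := ⟨b, le_of_lt hb⟩
  refine ⟨fun h => ?_, fun h => csInf_le hbdd h⟩
  have key : ∀ y ∈ Ioi x, u ≤ F y := fun y hy => by
    obtain ⟨z, hz, hzy⟩ := exists_lt_of_csInf_lt hne (lt_of_le_of_lt h hy)
    exact le_trans hz (F.mono hzy.le)
  have hr : Tendsto F (𝓝[>] x) (𝓝 (F x)) :=
    (F.right_continuous' x).mono_left (nhdsWithin_mono _ Ioi_subset_Ici_self)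
  exact ge_of_tendsto hr (eventually_of_mem self_mem_nhdsWithin key)

theorem monotoneOn_quantile (F : DistFun) : MonotoneOn F.quantile (Ioo 0 1) :=
  fun _ hu _ hv huv =>
    (F.quantile_le_iff hu _).2 (huv.trans ((F.quantile_le_iff hv _).1 le_rfl))

theorem aemeasurable_quantile (F : DistFun) :
    AEMeasurable F.quantile (volume.restrict (Ioo 0 1)) :=
  aemeasurable_restrict_of_monotoneOn measurableSet_Ioo F.monotoneOn_quantile

theorem map_quantile (F : DistFun) :
    (volume.restrict (Ioo (0 : ℝ) 1)).map F.quantile = F.law := by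
  refine Measure.ext_of_Iic _ _ fun x => ?_
  rw [Measure.map_apply_of_aemeasurable F.aemeasurable_quantile measurableSet_Iic, law_Iic,
    Measure.restrict_apply₀' measurableSet_Ioo.nullMeasurableSet]
  have h : F.quantile ⁻¹' Iic x ∩ Ioo 0 1 = Iic (F x) ∩ Ioo 0 1 := by
    ext u
    exact and_congr_left fun hu => F.quantile_le_iff hu x
  rw [h]
  -- The set lies between an open and a half-open interval, both of length F x.
  refine le_antisymm ?_ ?_
  · refine (measure_mono (t := Ioc 0 (F x)) fun u hu => ⟨hu.2.1, hu.1⟩).trans ?_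
    simp
  · refine le_trans ?_ (measure_mono (s := Ioo 0 (F x))
      fun u hu => ⟨hu.2.le, hu.1, hu.2.trans_le (F.le_one x)⟩)
    simp

/-- The comonotone coupling of two CDFs belongs to their set of couplings. -/
theorem map_quantile_prodMk_mem_couplings (F G : DistFun) :
    (volume.restrict (Ioo (0 : ℝ) 1)).map (fun u => (F.quantile u, G.quantile u)) ∈
      couplings F G := by
  have h := F.aemeasurable_quantile.prodMk G.aemeasurable_quantile
  constructor
  · rw [AEMeasurable.map_map_of_aemeasurable measurable_fst.aemeasurable h]
    exact F.map_quantile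
  · rw [AEMeasurable.map_map_of_aemeasurable measurable_snd.aemeasurable h]
    exact G.map_quantile

theorem volume_Ico_union_Ico (a b : ℝ) :
    volume (Ico a b ∪ Ico b a) = ENNReal.ofReal |a - b| := by
  rcases le_total a b with h | h
  · rw [Ico_eq_empty (not_lt.2 h), union_empty, Real.volume_Ico, abs_sub_comm,
      abs_of_nonneg (sub_nonneg.2 h)]
  · rw [Ico_eq_empty (not_lt.2 h), empty_union, Real.volume_Ico, abs_of_nonneg (sub_nonneg.2 h)]

/-- The Wasserstein distance is at most the `L¹` distance of the CDFs. -/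
theorem W₁_le_lintegral (F G : DistFun) :
    W₁ F G ≤ ∫⁻ x, ENNReal.ofReal |F x - G x| := by
  refine (iInf₂_le _ (map_quantile_prodMk_mem_couplings F G)).trans ?_
  have h := F.aemeasurable_quantile.prodMk G.aemeasurable_quantile
  rw [lintegral_map' (by fun_prop) h]
  -- The region between the two graphs. For u in (0, 1) its section is the interval between the two
  -- quantiles; at fixed x it is the interval between F x and G x. Tonelli compares the two.
  let S : Set (ℝ × ℝ) := {p | (p.1 ≤ F p.2 ∧ ¬ p.1 ≤ G p.2) ∨ (p.1 ≤ G p.2 ∧ ¬ p.1 ≤ F p.2)}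
  have mF : Measurable F := Monotone.measurable F.mono'
  have mG : Measurable G := Monotone.measurable G.mono'
  have hF : MeasurableSet {p : ℝ × ℝ | p.1 ≤ F p.2} :=
    measurableSet_le measurable_fst (mF.comp measurable_snd)
  have hG : MeasurableSet {p : ℝ × ℝ | p.1 ≤ G p.2} :=
    measurableSet_le measurable_fst (mG.comp measurable_snd)
  have hS : MeasurableSet S := (hF.diff hG).union (hG.diff hF)
  calc ∫⁻ u in Ioo (0 : ℝ) 1, ENNReal.ofReal |F.quantile u - G.quantile u|
      = ∫⁻ u in Ioo (0 : ℝ) 1, ∫⁻ x, S.indicator 1 (u, x) := by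
        refine setLIntegral_congr_fun measurableSet_Ioo fun u hu => ?_
        have e : (fun x => S.indicator (1 : ℝ × ℝ → ℝ≥0∞) (u, x)) =
            (Ico (F.quantile u) (G.quantile u) ∪ Ico (G.quantile u) (F.quantile u)).indicator
              1 := by
          funext x
          refine indicator_eq_indicator (Iff.symm ?_) rfl
          simp only [S, mem_union, mem_Ico, mem_ofPred_eq, ← not_le,
            F.quantile_le_iff hu, G.quantile_le_iff hu]
        rw [e, lintegral_indicator_one (measurableSet_Ico.union measurableSet_Ico),
          volume_Ico_union_Ico]
    _ = ∫⁻ x, ∫⁻ u in Ioo (0 : ℝ) 1, S.indicator 1 (u, x) :=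
        lintegral_lintegral_swap (f := fun u x => S.indicator 1 (u, x))
          (measurable_one.indicator hS).aemeasurable
    _ ≤ ∫⁻ x, ENNReal.ofReal |F x - G x| := by
        refine lintegral_mono fun x => ?_
        refine (lintegral_mono' Measure.restrict_le_self le_rfl).trans ?_
        have e : (fun u => S.indicator (1 : ℝ × ℝ → ℝ≥0∞) (u, x)) =
            (Ioc (G x) (F x) ∪ Ioc (F x) (G x)).indicator 1 := by
          funext u
          refine indicator_eq_indicator ?_ rfl
          simp only [S, mem_union, mem_Ioc, mem_ofPred_eq, not_le, and_comm]
        rw [e, lintegral_indicator_one (measurableSet_Ioc.union measurableSet_Ioc)]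
        rcases le_total (F x) (G x) with h | h
        · rw [Ioc_eq_empty (not_lt.2 h), empty_union, Real.volume_Ioc, abs_sub_comm,
            abs_of_nonneg (sub_nonneg.2 h)]
        · rw [Ioc_eq_empty (not_lt.2 h), union_empty, Real.volume_Ioc,
            abs_of_nonneg (sub_nonneg.2 h)]

theorem W₁_self (F : DistFun) : W₁ F F = 0 := by
  simpa using F.W₁_le_lintegral F

end DistFun
end

/-! ### Exponential moments and concentration of the mean deviation. -/

noncomputable section

theorem ProbabilityTheory.HasSubgaussianMGF.lintegral_exp_mul_abs_le {Ω : Type*}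
    [MeasurableSpace Ω] {P : Measure Ω} {Z : Ω → ℝ} {c : NNReal} (h : HasSubgaussianMGF Z c P) (t : ℝ) :
    ∫⁻ ω, ENNReal.ofReal (Real.exp (t * |Z ω|)) ∂P ≤
      ENNReal.ofReal (2 * Real.exp (c * t ^ 2 / 2)) := by
  have hle : ∀ ω, Real.exp (t * |Z ω|) ≤ Real.exp (t * Z ω) + Real.exp (-t * Z ω) := by
    intro ω
    rcases abs_cases (Z ω) with ⟨e, _⟩ | ⟨e, _⟩ <;> rw [e]
    · linarith [Real.exp_pos (-t * Z ω)]
    · rw [mul_neg, ← neg_mul]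
      linarith [Real.exp_pos (t * Z ω)]
  have hi := (h.integrable_exp_mul t).add (h.integrable_exp_mul (-t))
  calc ∫⁻ ω, ENNReal.ofReal (Real.exp (t * |Z ω|)) ∂P
      ≤ ∫⁻ ω, ENNReal.ofReal (Real.exp (t * Z ω) + Real.exp (-t * Z ω)) ∂P :=
        lintegral_mono fun ω => ENNReal.ofReal_le_ofReal (hle ω)
    _ = ENNReal.ofReal (mgf Z P t + mgf Z P (-t)) := by
        rw [mgf, mgf, ← integral_add (h.integrable_exp_mul t) (h.integrable_exp_mul (-t))]
        exact (ofReal_integral_eq_lintegral_ofReal hi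
          (ae_of_all _ fun ω => add_nonneg (Real.exp_pos _).le (Real.exp_pos _).le)).symm
    _ ≤ _ := by
        refine ENNReal.ofReal_le_ofReal ?_
        have h1 := h.mgf_le t
        have h2 := h.mgf_le (-t)
        rw [neg_sq] at h2
        linarith

namespace DistFun

variable {Ω : Type*} [MeasurableSpace Ω] {P : Measure Ω} [IsProbabilityMeasure P] {n : ℕ}

theorem abs_sub_le_one (F G : DistFun) (x : ℝ) : |F x - G x| ≤ 1 := by
  rw [abs_le]
  constructor <;> linarith [F.nonneg x, F.le_one x, G.nonneg x, G.le_one x]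

theorem measurable_apply (F : DistFun) : Measurable F := Monotone.measurable F.mono'

theorem measurable_empirical (hn : 1 ≤ n) {Y : Fin n → Ω → ℝ} (hY : ∀ i, Measurable (Y i)) :
    Measurable fun p : Ω × ℝ => empirical hn (fun i => Y i p.1) p.2 := by
  change Measurable fun p : Ω × ℝ =>
    (1 / (n : ℝ)) * ∑ i, (if Y i p.1 ≤ p.2 then (1 : ℝ) else 0)
  refine Measurable.const_mul (Finset.measurable_fun_sum _ fun i _ => ?_) _
  exact Measurable.ite (measurableSet_le ((hY i).comp measurable_fst) measurable_snd)
    measurable_const measurable_const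

/-- The factor n turns the deviation into a sum of independent centred indicators, each with
parameter 1/4 by Hoeffding's lemma. -/
theorem hasSubgaussianMGF_empirical (hn : 1 ≤ n) {Y : Fin n → Ω → ℝ}
    (hY : ∀ i, Measurable (Y i)) (hind : iIndepFun Y P) (F : DistFun)
    (hF : ∀ i x, P.real {ω | Y i ω ≤ x} = F x) (x : ℝ) :
    HasSubgaussianMGF (fun ω => n * (empirical hn (fun i => Y i ω) x - F x))
      (n * (1 / 2) ^ 2) P := by
  let g : ℝ → ℝ := (Iic x).indicator 1
  have hg : Measurable g := measurable_one.indicator measurableSet_Iic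
  have hmean : ∀ i, P[fun ω => g (Y i ω)] = F x := fun i => by
    have e : (fun ω => g (Y i ω)) = {ω | Y i ω ≤ x}.indicator 1 := rfl
    rw [e, integral_indicator_one (measurableSet_le (hY i) measurable_const), hF]
  have hsub : ∀ i ∈ Finset.univ, HasSubgaussianMGF (fun ω => g (Y i ω) - F x) ((1 / 2) ^ 2) P := by
    intro i _
    have h := hasSubgaussianMGF_of_mem_Icc (μ := P) (X := fun ω => g (Y i ω)) (a := 0) (b := 1)
      (hg.comp (hY i)).aemeasurable (ae_of_all _ fun ω => by
        by_cases h : Y i ω ∈ Iic x <;> simp [g, h])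
    rw [hmean i] at h
    simpa using h
  have h := HasSubgaussianMGF.sum_of_iIndepFun
    (hind.comp (fun _ y => g y - F x) fun _ => hg.sub_const _) hsub
  have hn' : (n : ℝ) ≠ 0 := by positivity
  convert h using 1
  · funext ω
    change (n : ℝ) * ((1 / (n : ℝ)) * ∑ i, (if Y i ω ≤ x then (1 : ℝ) else 0) - F x) =
      ∑ i, ((Iic x).indicator 1 (Y i ω) - F x)
    simp only [Finset.sum_sub_distrib, indicator_apply, mem_Iic, Pi.one_apply, Finset.sum_const,
      Finset.card_univ, Fintype.card_fin, nsmul_eq_mul]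
    field_simp
  · simp

theorem integrable_abs_sub (F G : DistFun) (ν : Measure ℝ) [IsFiniteMeasure ν] :
    Integrable (fun x => |F x - G x|) ν :=
  Integrable.of_bound (F.measurable_apply.sub G.measurable_apply).abs.aestronglyMeasurable 1
    (ae_of_all _ fun x => by simpa using F.abs_sub_le_one G x)

/-- Jensen's inequality for the exponential of the mean deviation of two CDFs. -/
theorem ofReal_exp_mul_integral_le (F G : DistFun) (ν : Measure ℝ) [IsProbabilityMeasure ν]
    {t : ℝ} (ht : 0 ≤ t) :
    ENNReal.ofReal (Real.exp (t * ∫ x, |F x - G x| ∂ν)) ≤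
      ∫⁻ x, ENNReal.ofReal (Real.exp (t * |F x - G x|)) ∂ν := by
  have hm : Measurable fun x => t * |F x - G x| :=
    (F.measurable_apply.sub G.measurable_apply).abs.const_mul t
  have hi : Integrable (fun x => Real.exp (t * |F x - G x|)) ν :=
    Integrable.of_bound hm.exp.aestronglyMeasurable (Real.exp t) (ae_of_all _ fun x => by
      rw [Real.norm_eq_abs, Real.abs_exp, Real.exp_le_exp]
      exact mul_le_of_le_one_right ht (F.abs_sub_le_one G x))
  rw [← ofReal_integral_eq_lintegral_ofReal hi (ae_of_all _ fun _ => (Real.exp_pos _).le),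
    ← integral_const_mul]
  exact ENNReal.ofReal_le_ofReal <| convexOn_exp.map_integral_le
    Real.continuous_exp.continuousOn isClosed_univ (ae_of_all _ fun _ => mem_univ _)
    ((F.integrable_abs_sub G ν).const_mul t) hi

/-- A Dvoretzky–Kiefer–Wolfowitz type inequality in which the supremum is replaced by the mean
with respect to a fixed probability measure. -/
theorem measure_le_integral_abs_empirical_sub_le (hn : 1 ≤ n) {Y : Fin n → Ω → ℝ}
    (hY : ∀ i, Measurable (Y i)) (hind : iIndepFun Y P) (F : DistFun)
    (hF : ∀ i x, P.real {ω | Y i ω ≤ x} = F x) (ν : Measure ℝ) [IsProbabilityMeasure ν]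
    {δ : ℝ} (hδ : 0 ≤ δ) :
    P {ω | δ ≤ ∫ x, |empirical hn (fun i => Y i ω) x - F x| ∂ν} ≤
      ENNReal.ofReal (2 * Real.exp (-(2 * n * δ ^ 2))) := by
  -- Minimises the Chernoff exponent t²/(8n) - tδ, with value -2nδ².
  set t : ℝ := 4 * δ * n with ht
  have ht0 : 0 ≤ t := by positivity
  have hm : Measurable fun p : Ω × ℝ =>
      ENNReal.ofReal (Real.exp (t * |empirical hn (fun i => Y i p.1) p.2 - F p.2|)) :=
    (((measurable_empirical hn hY).sub
      (F.measurable_apply.comp measurable_snd)).abs.const_mul t).exp.ennreal_ofReal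
  set J : Ω → ℝ≥0∞ := fun ω =>
    ∫⁻ x, ENNReal.ofReal (Real.exp (t * |empirical hn (fun i => Y i ω) x - F x|)) ∂ν with hJ
  have hJm : Measurable J := hm.lintegral_prod_right'
  have hint : ∫⁻ ω, J ω ∂P ≤ ENNReal.ofReal (2 * Real.exp (2 * n * δ ^ 2)) := by
    rw [hJ, lintegral_lintegral_swap hm.aemeasurable]
    refine (lintegral_mono (g := fun _ => ENNReal.ofReal (2 * Real.exp (2 * n * δ ^ 2)))
      fun x => ?_).trans (by simp)
    -- The parameter is t/n, since the sub-Gaussian variable already carries the factor n.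
    have h := (hasSubgaussianMGF_empirical hn hY hind F hF x).lintegral_exp_mul_abs_le (4 * δ)
    refine le_trans (le_of_eq ?_) (h.trans (le_of_eq ?_))
    · refine lintegral_congr fun ω => ?_
      rw [abs_mul, Nat.abs_cast, ht, mul_assoc (4 * δ)]
    · push_cast
      ring_nf
  have hmar := mul_meas_ge_le_lintegral (μ := P) hJm (ENNReal.ofReal (Real.exp (t * δ)))
  have hsub : {ω | δ ≤ ∫ x, |empirical hn (fun i => Y i ω) x - F x| ∂ν} ⊆
      {ω | ENNReal.ofReal (Real.exp (t * δ)) ≤ J ω} := fun ω hω =>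
    (ENNReal.ofReal_le_ofReal (Real.exp_le_exp.2 (mul_le_mul_of_nonneg_left hω ht0))).trans
      (ofReal_exp_mul_integral_le _ F ν ht0)
  refine (measure_mono hsub).trans ?_
  have h1 : ENNReal.ofReal (Real.exp (t * δ)) ≠ 0 := by simp [Real.exp_pos]
  refine (ENNReal.mul_le_mul_iff_right h1 ENNReal.ofReal_ne_top).1
    ((hmar.trans hint).trans (le_of_eq ?_))
  rw [← ENNReal.ofReal_mul (Real.exp_pos _).le, mul_left_comm, ← Real.exp_add, ht]
  ring_nf

end DistFun
end

/-! ### CDFs of bounded support and the reduction of Type 2 to a Hölder bound. -/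

noncomputable section

namespace DistFun

/-- If two CDFs agree off an interval, their Wasserstein distance is at most the length of the
interval times the mean of their deviation over it. -/
theorem W₁_le_mul_integral_cond (F G : DistFun) {a b : ℝ} (hab : a < b)
    (h : ∀ x ∉ Icc a b, F x = G x) :
    W₁ F G ≤ ENNReal.ofReal ((b - a) * ∫ x, |F x - G x| ∂volume[|Icc a b]) := by
  have hvol : volume (Icc a b) = ENNReal.ofReal (b - a) := Real.volume_Icc
  have hpos : ENNReal.ofReal (b - a) ≠ 0 := by simpa using hab
  refine (W₁_le_lintegral F G).trans (le_of_eq ?_)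
  have e : (fun x => ENNReal.ofReal |F x - G x|) =
      (Icc a b).indicator fun x => ENNReal.ofReal |F x - G x| := by
    refine (indicator_eq_self.2 fun x hx => ?_).symm
    by_contra hx'
    simp [h x hx'] at hx
  rw [ENNReal.ofReal_mul (sub_nonneg.2 hab.le),
    ofReal_integral_eq_lintegral_ofReal (F.integrable_abs_sub G _)
      (ae_of_all _ fun _ => abs_nonneg _),
    ProbabilityTheory.cond, lintegral_smul_measure, hvol, smul_eq_mul, ← mul_assoc,
    ENNReal.mul_inv_cancel hpos ENNReal.ofReal_ne_top, one_mul, e,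
    lintegral_indicator measurableSet_Icc, setLIntegral_indicator measurableSet_Icc, inter_self]

theorem empirical_eq_one {n : ℕ} (hn : 1 ≤ n) {x : Fin n → ℝ} {t : ℝ} (h : ∀ i, x i ≤ t) :
    empirical hn x t = 1 := by
  change (1 / (n : ℝ)) * ∑ i, (if x i ≤ t then (1 : ℝ) else 0) = 1
  have hn' : (n : ℝ) ≠ 0 := by positivity
  simp [h, hn']

theorem empirical_eq_zero {n : ℕ} (hn : 1 ≤ n) {x : Fin n → ℝ} {t : ℝ} (h : ∀ i, t < x i) :
    empirical hn x t = 0 := by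
  change (1 / (n : ℝ)) * ∑ i, (if x i ≤ t then (1 : ℝ) else 0) = 0
  simp [fun i => not_le.2 (h i)]

variable {Ω : Type*} [MeasurableSpace Ω] {P : Measure Ω} [IsProbabilityMeasure P] {X : Ω → ℝ}

theorem ofRV_eq_one (hX : AEMeasurable X P) {t : ℝ} (h : ∀ᵐ ω ∂P, X ω ≤ t) :
    ofRV P X t = 1 := by
  have h1 : P {ω | X ω ≤ t} = 1 := by
    rw [measure_eq_measure_of_null_sdiff (subset_univ _) ?_, measure_univ]
    rwa [← compl_eq_univ_sdiff]
  rw [ofRV_apply P hX, measureReal_def, h1, ENNReal.toReal_one]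

theorem ofRV_eq_zero (hX : AEMeasurable X P) {t : ℝ} (h : ∀ᵐ ω ∂P, t < X ω) :
    ofRV P X t = 0 := by
  have h0 : P {ω | X ω ≤ t} = 0 := measure_eq_zero_iff_ae_notMem.2 (h.mono fun _ => not_le.2)
  rw [ofRV_apply P hX, measureReal_def, h0, ENNReal.toReal_zero]

end DistFun

namespace IsTypeTwo

variable {ρ : RiskMeasure} {α₁ α₂ α₃ L₁ L₂ L₃ K₁ K₂ γ : ℝ}

theorem ofReal_abs_sub_trunc_le (h : IsTypeTwo ρ α₁ α₂ α₃ L₁ L₂ L₃ K₁ K₂ γ) {F : DistFun}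
    (G : DistFun) {τ : ℝ} (hτ : 0 < τ) (h1 : ∀ z, K₁ * τ < z → F z = 1)
    (h0 : ∀ z, z < -(K₂ * τ) → F z = 0) :
    ENNReal.ofReal |ρ F - ρ (G.trunc τ)| ≤
      ENNReal.ofReal L₁ * DistFun.W₁ F G ^ α₁ * ENNReal.ofReal (τ ^ γ) := by
  have e1 : ∫⁻ z in Ioi (K₁ * τ), ENNReal.ofReal (1 - F z) ^ α₂ = 0 :=
    setLIntegral_eq_zero measurableSet_Ioi fun z hz => by
      simp [h1 z hz, ENNReal.zero_rpow_of_pos h.α₂_pos]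
  have e0 : ∫⁻ z in Iio (-(K₂ * τ)), ENNReal.ofReal (F z) ^ α₃ = 0 :=
    setLIntegral_eq_zero measurableSet_Iio fun z hz => by
      simp [h0 z hz, ENNReal.zero_rpow_of_pos h.α₃_pos]
  simpa [e1, e0] using h.bound F G τ hτ

/-- With G = F every term on the right of the Type 2 condition is zero. The truncation itself may
alter F, for instance when K₁ > 1; only the value of ρ is preserved. -/
theorem apply_trunc_eq (h : IsTypeTwo ρ α₁ α₂ α₃ L₁ L₂ L₃ K₁ K₂ γ) {F : DistFun} {τ : ℝ}
    (hτ : 0 < τ) (h1 : ∀ z, K₁ * τ < z → F z = 1) (h0 : ∀ z, z < -(K₂ * τ) → F z = 0) :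
    ρ (F.trunc τ) = ρ F := by
  have := h.ofReal_abs_sub_trunc_le F hτ h1 h0
  rw [F.W₁_self, ENNReal.zero_rpow_of_pos h.α₁_pos, mul_zero, zero_mul, nonpos_iff_eq_zero,
    ENNReal.ofReal_eq_zero] at this
  exact (sub_eq_zero.1 (abs_eq_zero.1 (le_antisymm this (abs_nonneg _)))).symm

/-- On CDFs whose mass lies in the window of the truncation level `τ`, a risk measure of Type 2 is
Hölder continuous with respect to the Wasserstein distance. -/
theorem abs_sub_le (h : IsTypeTwo ρ α₁ α₂ α₃ L₁ L₂ L₃ K₁ K₂ γ) {F G : DistFun} {τ w : ℝ}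
    (hτ : 0 < τ) (hF1 : ∀ z, K₁ * τ < z → F z = 1) (hF0 : ∀ z, z < -(K₂ * τ) → F z = 0)
    (hG1 : ∀ z, K₁ * τ < z → G z = 1) (hG0 : ∀ z, z < -(K₂ * τ) → G z = 0)
    (hw : 0 ≤ w) (hW : DistFun.W₁ F G ≤ ENNReal.ofReal w) :
    |ρ F - ρ G| ≤ L₁ * w ^ α₁ * τ ^ γ := by
  have hL := h.L₁_pos.le
  have hwα := Real.rpow_nonneg hw α₁
  rw [← ENNReal.ofReal_le_ofReal_iff (by positivity), ← h.apply_trunc_eq hτ hG1 hG0,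
    ENNReal.ofReal_mul (by positivity), ENNReal.ofReal_mul hL,
    ← ENNReal.ofReal_rpow_of_nonneg hw h.α₁_pos.le]
  refine (h.ofReal_abs_sub_trunc_le G hτ hF1 hF0).trans ?_
  have := h.α₁_pos.le
  gcongr

end IsTypeTwo
end

/-! ### The concentration bound. -/

theorem mainTheorem3 (B₁ B₂ : ℝ) (hB : 0 < B₁ ∨ 0 < B₂) :
    ∃ c₁ c₂ : ℝ, 0 < c₁ ∧ 0 < c₂ ∧
      ∀ (Ω Ω' : Type*) [MeasurableSpace Ω] [MeasurableSpace Ω']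
        (P : Measure Ω) (P' : Measure Ω') [IsProbabilityMeasure P] [IsProbabilityMeasure P']
        (X : Ω → ℝ) (n : ℕ) (hn : 1 ≤ n) (Xs : Fin n → Ω' → ℝ)
        (ρ : RiskMeasure) (α₁ α₂ α₃ L₁ L₂ L₃ K₁ K₂ γ : ℝ) (ε : ℝ),
        (∀ᵐ ω ∂P, X ω ∈ Icc (-B₂) B₁) →
        iIndepFun Xs P' →
        (∀ i, IdentDistrib (Xs i) X P' P) →
        IsTypeTwo ρ α₁ α₂ α₃ L₁ L₂ L₃ K₁ K₂ γ →
        0 < ε →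
        P'.real {ω | ε < |ρ (DistFun.empirical hn (fun i => Xs i ω)) - ρ (DistFun.ofRV P X)|} ≤
          c₁ * Real.exp (-(c₂ * n * (ε / (L₁ * (max (B₁ / K₁) (B₂ / K₂)) ^ γ)) ^ (2 / α₁))) := by
  -- The added 1 keeps the interval nondegenerate when B₁ = -B₂, so that a uniform law on it exists.
  set D : ℝ := |B₁ + B₂| + 1 with hD
  have hDpos : 0 < D := by positivity
  refine ⟨2, 2 / D ^ 2, two_pos, by positivity, ?_⟩
  intro Ω Ω' _ _ P P' _ _ X n hn Xs ρ α₁ α₂ α₃ L₁ L₂ L₃ K₁ K₂ γ ε hX hind hid hρ hε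
  set τ := max (B₁ / K₁) (B₂ / K₂) with hτdef
  have hα := hρ.α₁_pos
  have hK₁ := hρ.K₁_pos
  have hK₂ := hρ.K₂_pos
  have hτ : 0 < τ := hB.elim (fun h => lt_max_of_lt_left (div_pos h hK₁))
    (fun h => lt_max_of_lt_right (div_pos h hK₂))
  have hB₁ : B₁ ≤ K₁ * τ := by
    rw [mul_comm, ← div_le_iff₀ hK₁]
    exact le_max_left _ _
  have hB₂ : B₂ ≤ K₂ * τ := by
    rw [mul_comm, ← div_le_iff₀ hK₂]
    exact le_max_right _ _
  have hBD : B₁ ≤ -B₂ + D := by linarith [le_abs_self (B₁ + B₂)]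
  set F := DistFun.ofRV P X with hFdef
  have hXm i : AEMeasurable (Xs i) P' := (hid i).aemeasurable_fst
  have hXm' : AEMeasurable X P :=
    (hid ⟨0, hn⟩).aemeasurable_snd
  have hF1 z (hz : B₁ < z) : F z = 1 :=
    DistFun.ofRV_eq_one hXm' (hX.mono fun ω h => h.2.trans hz.le)
  have hF0 z (hz : z < -B₂) : F z = 0 :=
    DistFun.ofRV_eq_zero hXm' (hX.mono fun ω h => hz.trans_le h.1)
  -- The samples are only almost everywhere measurable; measurable versions provide the joint
  -- measurability in (ω, x) that Tonelli requires.
  let Y : Fin n → Ω' → ℝ := fun i => (hXm i).mk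
  have hYm i : Measurable (Y i) := (hXm i).measurable_mk
  have hYX i : Xs i =ᵐ[P'] Y i := (hXm i).ae_eq_mk
  have hYF i x : P'.real {ω | Y i ω ≤ x} = F x := by
    rw [hFdef, DistFun.ofRV_apply P hXm']
    refine congrArg ENNReal.toReal
      (Eq.trans (measure_congr ?_) ((hid i).measure_mem_eq (s := Iic x) measurableSet_Iic))
    filter_upwards [hYX i] with ω hω
    exact congrArg (· ≤ x) hω.symm
  have hXs : ∀ᵐ ω ∂P', ∀ i, Xs i ω = Y i ω ∧ Xs i ω ∈ Icc (-B₂) B₁ :=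
    ae_all_iff.2 fun i => (hYX i).and ((hid i).symm.ae_mem_snd measurableSet_Icc hX)
  set s := ε / (L₁ * τ ^ γ) with hs
  have hLτ : 0 < L₁ * τ ^ γ := mul_pos hρ.L₁_pos (Real.rpow_pos_of_pos hτ γ)
  have hs0 : 0 < s := div_pos hε hLτ
  have hne : volume (Icc (-B₂) (-B₂ + D)) ≠ 0 := by simpa using hDpos
  have hprob : IsProbabilityMeasure (volume[|Icc (-B₂) (-B₂ + D)]) :=
    cond_isProbabilityMeasure_of_finite hne (by simp)
  have htail := DistFun.measure_le_integral_abs_empirical_sub_le hn hYm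
    (hind.congr hYX) F hYF (volume[|Icc (-B₂) (-B₂ + D)])
    -- If the mean deviation is w, then W₁ ≤ D w, so W₁ ≥ s^(1/α₁) forces w to be at least this δ.
    (δ := s ^ (1 / α₁) / D) (by positivity)
  refine ENNReal.toReal_le_of_le_ofReal (by positivity) ?_
  refine le_trans (measure_mono_ae ?_) (htail.trans (le_of_eq ?_))
  · filter_upwards [hXs] with ω hω hlt
    have hemp : (fun i => Y i ω) = fun i => Xs i ω := funext fun i => (hω i).1.symm
    change s ^ (1 / α₁) / D ≤ _
    rw [hemp]
    change ε < |ρ (DistFun.empirical hn fun i => Xs i ω) - ρ F| at hlt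
    set E := DistFun.empirical hn fun i => Xs i ω with hE
    have hE1 z (hz : B₁ < z) : E z = 1 :=
      DistFun.empirical_eq_one hn fun i => (hω i).2.2.trans hz.le
    have hE0 z (hz : z < -B₂) : E z = 0 :=
      DistFun.empirical_eq_zero hn fun i => hz.trans_le (hω i).2.1
    have hW := E.W₁_le_mul_integral_cond F (a := -B₂) (b := -B₂ + D) (by linarith) fun z hz => by
      rcases lt_or_ge z (-B₂) with h | h
      · rw [hE0 z h, hF0 z h]
      · have h' : B₁ < z := hBD.trans_lt (not_le.1 fun h'' => hz ⟨h, h''⟩)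
        rw [hE1 z h', hF1 z h']
    rw [add_sub_cancel_left] at hW
    set w := ∫ x, |E x - F x| ∂volume[|Icc (-B₂) (-B₂ + D)] with hw
    have hw0 : 0 ≤ w := integral_nonneg fun _ => abs_nonneg _
    have hDw : 0 ≤ D * w := by positivity
    have hle := hρ.abs_sub_le hτ (fun z hz => hE1 z (hB₁.trans_lt hz))
      (fun z hz => hE0 z (hz.trans_le (neg_le_neg hB₂)))
      (fun z hz => hF1 z (hB₁.trans_lt hz))
      (fun z hz => hF0 z (hz.trans_le (neg_le_neg hB₂))) hDw hW
    have hsw : s ≤ (D * w) ^ α₁ := by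
      rw [hs, div_le_iff₀ hLτ]
      linarith
    rw [div_le_iff₀ hDpos, mul_comm w, one_div,
      Real.rpow_inv_le_iff_of_pos hs0.le hDw hα]
    exact hsw
  · have e : s ^ (2 / α₁) = (s ^ (1 / α₁)) ^ 2 := by
      rw [← Real.rpow_natCast, ← Real.rpow_mul hs0.le]
      congr 1
      push_cast
      ring
    rw [e]
    congr 3
    field_simp
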